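/- Let $A$ be a complex Banach algebra with unit $1$. For $a,b\in A$ let $C_{a,b}:A\to A$ be the bounded linear operator $C_{a,b}x=ax-xb$, and put \[\rho(a,b)=\limsup_{n\to\infty}\|C_{a,b}^n1\|^{1/n},\qquad d(a,b)=\max\{\rho(a,b),\rho(b,a)\}.\] The elements $a$ and $b$ are called quasinilpotent equivalent if $d(a,b)=0$. If $\lambda$ is an isolated point of the spectrum $\sigma(a)$, the Riesz projection associated with $a$ and $\lambda$ is \[p(\lambda,a)=\frac1{2\pi i}\int_{\Gamma_\lambda}(z-a)^{-1}\,dz,\] where $\Gamma_\lambda$ is a small positively oriented circle centred at $\lambda$ that isolates $\lambda$ from the rest of $\sigma(a)$. Theorem. Let $a,b\in A$ and suppose that $\sigma(a)$ is finite. Then $d(a,b)=0$ if and only if the following two conditions hold: (i) $\sigma(a)=\sigma(b)$; (ii) $p(\lambda,a)=p(\lambda,b)$ for each $\lambda\in\sigma(a)$. -/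

import Mathlib

open Filter Metric

namespace BanachAlg

noncomputable section

variable {A : Type*} [NormedRing A] [NormedAlgebra ℂ A]

/-- The bounded operator `C_{a,b} = L_a - R_b` on `A`, that is `x ↦ a * x - x * b`. -/
def commOp (a b : A) : A →L[ℂ] A :=
  ContinuousLinearMap.mul ℂ A a - (ContinuousLinearMap.mul ℂ A).flip b

theorem commOp_apply (a b x : A) : commOp a b x = a * x - x * b := by
  simp [commOp]

/-- `ρ(a,b) = limsup_n ‖C_{a,b}^n 1‖^{1/n}`, a real number. The sequence is bounded, see
`isBoundedUnder_rho` and `isCoboundedUnder_rho`, so that this is the genuine upper limit. -/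
def rho (a b : A) : ℝ :=
  limsup (fun n : ℕ => ‖(commOp a b ^ n) (1 : A)‖ ^ (1 / (n : ℝ))) atTop

/-- The spectral semidistance `d(a,b) = max {ρ(a,b), ρ(b,a)}`. -/
def spectralSemidist (a b : A) : ℝ :=
  max (rho a b) (rho b a)

/-- `r` is the radius of a circle about `z` that isolates `z` from the remaining spectrum of `a`:
the closed disc bounded by the circle meets the spectrum of `a` at most in `z`. -/
def IsIsolatingRadius (a : A) (z : ℂ) (r : ℝ) : Prop :=
  0 < r ∧ closedBall z r ∩ spectrum ℂ a ⊆ {z}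

open Classical in
/-- The Riesz projection `p(z,a) = (2πi)⁻¹ ∮_Γ (w - a)⁻¹ dw`, where `Γ` is a (positively oriented)
circle about `z` that isolates `z` from the remaining spectrum of `a`. The value does not depend on
the radius, see `rieszProjection_eq`. If there is no such circle (that is, if `z` is an accumulation
point of the spectrum), the value is `0` by convention. -/
def rieszProjection (z : ℂ) (a : A) : A :=
  if h : ∃ r : ℝ, IsIsolatingRadius a z r then
    (2 * (Real.pi : ℂ) * Complex.I)⁻¹ • ∮ w in C(z, h.choose), resolvent a w
  else 0

theorem isBoundedUnder_rho (a b : A) :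
    IsBoundedUnder (· ≤ ·) atTop
      (fun n : ℕ => ‖(commOp a b ^ n) (1 : A)‖ ^ (1 / (n : ℝ))) := by
  refine isBoundedUnder_of_eventually_le (a := ‖commOp a b‖ * max 1 ‖(1 : A)‖) ?_
  filter_upwards [eventually_ge_atTop 1] with n hn
  have hn' : n ≠ 0 := by omega
  have h1 : ‖(commOp a b ^ n) (1 : A)‖ ≤ (‖commOp a b‖ * max 1 ‖(1 : A)‖) ^ n := by
    calc ‖(commOp a b ^ n) (1 : A)‖ ≤ ‖commOp a b ^ n‖ * ‖(1 : A)‖ :=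
          ContinuousLinearMap.le_opNorm _ _
      _ ≤ ‖commOp a b‖ ^ n * (max 1 ‖(1 : A)‖) ^ n := by
          gcongr
          · exact norm_pow_le' _ hn
          · exact (le_max_right _ _).trans (le_self_pow₀ (le_max_left _ _) hn')
      _ = _ := (mul_pow _ _ _).symm
  calc ‖(commOp a b ^ n) (1 : A)‖ ^ (1 / (n : ℝ))
      ≤ ((‖commOp a b‖ * max 1 ‖(1 : A)‖) ^ n) ^ (1 / (n : ℝ)) := by gcongr
    _ = _ := by
      rw [one_div]
      exact Real.pow_rpow_inv_natCast (by positivity) hn'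

theorem isCoboundedUnder_rho (a b : A) :
    IsCoboundedUnder (· ≤ ·) atTop
      (fun n : ℕ => ‖(commOp a b ^ n) (1 : A)‖ ^ (1 / (n : ℝ))) :=
  (isBoundedUnder_of_eventually_ge (a := (0 : ℝ))
    (Eventually.of_forall fun n => by positivity)).isCoboundedUnder_le

/-- The contour integral is the same for all isolating radii. -/
theorem circleIntegral_resolvent_eq [CompleteSpace A] {a : A} {z : ℂ} {r s : ℝ}
    (hr : 0 < r) (hrs : r ≤ s) (hs : IsIsolatingRadius a z s) :
    (∮ w in C(z, s), resolvent a w) = ∮ w in C(z, r), resolvent a w := by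
  have key : ∀ w ∈ closedBall z s \ ball z r, DifferentiableAt ℂ (resolvent a) w := by
    intro w hw
    have hmem : w ∈ resolventSet ℂ a := by
      by_contra hc
      have : w = z := hs.2 ⟨hw.1, hc⟩
      subst this
      exact hw.2 (mem_ball_self hr)
    exact (spectrum.hasDerivAt_resolvent_const_left hmem).differentiableAt
  refine Complex.circleIntegral_eq_of_differentiable_on_annulus_off_countable hr hrs
    Set.countable_empty (fun w hw => (key w hw).continuousAt.continuousWithinAt) ?_
  intro w hw
  exact key w ⟨ball_subset_closedBall hw.1.1, fun h => hw.1.2 (ball_subset_closedBall h)⟩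

/-- The Riesz projection may be computed with any isolating circle. -/
theorem rieszProjection_eq [CompleteSpace A] {a : A} {z : ℂ} {r : ℝ}
    (hr : IsIsolatingRadius a z r) :
    rieszProjection z a =
      (2 * (Real.pi : ℂ) * Complex.I)⁻¹ • ∮ w in C(z, r), resolvent a w := by
  have h : ∃ r : ℝ, IsIsolatingRadius a z r := ⟨r, hr⟩
  rw [rieszProjection, dif_pos h]
  rcases le_total r h.choose with hle | hle
  · rw [circleIntegral_resolvent_eq hr.1 hle h.choose_spec]
  · rw [circleIntegral_resolvent_eq h.choose_spec.1 hle hr]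

end

end BanachAlg

namespace BanachAlg

noncomputable section

open Asymptotics Topology

/-! `d(a,b) = 0` means that `C_{a,b}^n 1` and `C_{b,a}^n 1` decay faster than every geometric
sequence. If (i) and (ii) hold, then `a` and `b` share the element `s = ∑ λ p(λ,a)`, which commutes
with both. By Gelfand theory `a - s` and `b - s` are quasinilpotent
(`commute_spectralSum_and_spectrum_subset`). Subtracting `s` does not change `C_{a,b}^n 1`, and for
quasinilpotent elements the binomial expansion gives the decay. Conversely, the decay makes `∑
(-1)^n (w - a)^{-(n+1)} C_{a,b}^n 1` converge off `σ(a)`, where it telescopes to a left inverse of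
`w - b`; a mirrored series in `C_{b,a}^n 1` gives a right inverse, so the spectra agree. Integrated
around `λ`, the terms with `n ≥ 1` have primitives and vanish, which leaves `p(λ,b) = p(λ,a)`. -/

/-- A sequence is subgeometric if it is dominated by every geometric sequence. -/
def IsSubgeometric {E : Type*} [Norm E] (u : ℕ → E) : Prop :=
  ∀ ε : ℝ, 0 < ε → u =O[atTop] fun n => ε ^ n

/-! ### Subgeometric decay and `n`-th roots. -/

section Subgeometric

variable {E : Type*} [NormedAddCommGroup E] {u : ℕ → E}

theorem IsSubgeometric.exists_bound (hu : IsSubgeometric u) {ε : ℝ} (hε : 0 < ε) :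
    ∃ M : ℝ, 0 < M ∧ ∀ n, ‖u n‖ ≤ M * ε ^ n := by
  obtain ⟨M, hM, h⟩ := bound_of_isBigO_nat_atTop (hu ε hε)
  refine ⟨M, hM, fun n => ?_⟩
  simpa [abs_of_pos hε] using h (x := n) (pow_ne_zero n hε.ne')

theorem isSubgeometric_of_tendsto
    (h : Tendsto (fun n : ℕ => ‖u n‖ ^ (1 / (n : ℝ))) atTop (𝓝 0)) : IsSubgeometric u := by
  intro ε hε
  refine IsBigO.of_bound 1 ?_
  filter_upwards [h.eventually_lt_const hε, eventually_ge_atTop 1] with n hn hn1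
  have hn0 : n ≠ 0 := by omega
  rw [one_mul, Real.norm_of_nonneg (by positivity)]
  rw [one_div] at hn
  calc ‖u n‖ = (‖u n‖ ^ ((n : ℝ)⁻¹)) ^ n := (Real.rpow_inv_natCast_pow (norm_nonneg _) hn0).symm
    _ ≤ ε ^ n := by gcongr

theorem IsSubgeometric.tendsto (hu : IsSubgeometric u) :
    Tendsto (fun n : ℕ => ‖u n‖ ^ (1 / (n : ℝ))) atTop (𝓝 0) := by
  rw [tendsto_order]
  refine ⟨fun c hc => Eventually.of_forall fun n => hc.trans_le (by positivity), fun c hc => ?_⟩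
  -- Passing from `c / 4` to `c / 2` absorbs the constant of the `O`; the room between `c / 2` and
  -- `c` makes the final bound strict.
  have hlittle : u =o[atTop] fun n => (c / 2) ^ n :=
    (hu (c / 4) (by positivity)).trans_isLittleO
      (isLittleO_pow_pow_of_lt_left (by positivity) (by linarith))
  filter_upwards [hlittle.bound one_pos, eventually_ge_atTop 1] with n hn hn1
  have hn0 : n ≠ 0 := by omega
  rw [one_mul, Real.norm_of_nonneg (by positivity)] at hn
  calc ‖u n‖ ^ (1 / (n : ℝ)) ≤ ((c / 2) ^ n) ^ (1 / (n : ℝ)) := by gcongr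
    _ = c / 2 := by rw [one_div]; exact Real.pow_rpow_inv_natCast (by positivity) hn0
    _ < c := by linarith

end Subgeometric

section

variable {A : Type*} [NormedRing A] [NormedAlgebra ℂ A]

/-! ### Vanishing of `ρ` and iterates of `C_{a,b}`. -/

theorem rho_nonneg (a b : A) : 0 ≤ rho a b :=
  le_limsup_of_frequently_le (Frequently.of_forall fun n => by positivity)
    (isBoundedUnder_rho a b)

theorem rho_eq_zero_iff {a b : A} :
    rho a b = 0 ↔ IsSubgeometric fun n => (commOp a b ^ n) (1 : A) := by
  refine ⟨fun h => isSubgeometric_of_tendsto ?_, fun h => h.tendsto.limsup_eq⟩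
  refine tendsto_of_le_liminf_of_limsup_le ?_ h.le (isBoundedUnder_rho a b)
    (isBoundedUnder_of_eventually_ge (a := (0 : ℝ)) (Eventually.of_forall fun n => by positivity))
  exact le_liminf_of_le (isBoundedUnder_rho a b).isCoboundedUnder_ge
    (Eventually.of_forall fun n => by positivity)

theorem spectralSemidist_eq_zero_iff {a b : A} :
    spectralSemidist a b = 0 ↔ rho a b = 0 ∧ rho b a = 0 := by
  have h1 := rho_nonneg a b
  have h2 := rho_nonneg b a
  refine ⟨fun h => ⟨le_antisymm (h ▸ le_max_left _ _) h1, le_antisymm (h ▸ le_max_right _ _) h2⟩,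
    fun h => by simp [spectralSemidist, h.1, h.2]⟩

theorem commOp_pow_succ_apply (a b x : A) (n : ℕ) :
    (commOp a b ^ (n + 1)) x = a * (commOp a b ^ n) x - (commOp a b ^ n) x * b := by
  rw [pow_succ', mul_apply_eq_comp, commOp_apply]

theorem isSubgeometric_pow_of_spectrum_subset [CompleteSpace A] {a : A}
    (h : spectrum ℂ a ⊆ {0}) : IsSubgeometric fun n => a ^ n := by
  have hr : spectralRadius ℂ a = 0 := by
    refine le_antisymm (iSup₂_le fun k hk => ?_) bot_le
    rw [Set.mem_singleton_iff.1 (h hk)]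
    simp
  have ht := spectrum.pow_norm_pow_one_div_tendsto_nhds_spectralRadius a
  rw [hr] at ht
  refine isSubgeometric_of_tendsto ?_
  have := (ENNReal.tendsto_toReal ENNReal.zero_ne_top).comp ht
  refine this.congr fun n => ?_
  simp only [Function.comp_apply]
  exact ENNReal.toReal_ofReal (by positivity)

/-- Left multiplication by `q` commutes with right multiplication by `r`, so the iterate is a signed
binomial sum of the products `q ^ i * r ^ k` with `i + k = n`. -/
theorem isSubgeometric_commOp_pow_one {q r : A} (hq : IsSubgeometric fun n => q ^ n)
    (hr : IsSubgeometric fun n => r ^ n) : IsSubgeometric fun n => (commOp q r ^ n) (1 : A) := by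
  intro ε hε
  obtain ⟨M, hM, hM'⟩ := hq.exists_bound (half_pos hε)
  obtain ⟨N, hN, hN'⟩ := hr.exists_bound (half_pos hε)
  -- The outer factors let the induction absorb one `q` or one `r` per step; each step doubles the
  -- number of terms, hence `2 ^ n`.
  have key : ∀ n j k : ℕ, ‖q ^ j * (commOp q r ^ n) (1 : A) * r ^ k‖ ≤
      M * N * 2 ^ n * (ε / 2) ^ (n + j + k) := by
    intro n
    induction n with
    | zero =>
      intro j k
      calc ‖q ^ j * (commOp q r ^ 0) (1 : A) * r ^ k‖ ≤ ‖q ^ j‖ * ‖r ^ k‖ := by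
            simpa using norm_mul_le (q ^ j) (r ^ k)
        _ ≤ (M * (ε / 2) ^ j) * (N * (ε / 2) ^ k) := by gcongr; exacts [hM' j, hN' k]
        _ = _ := by ring
    | succ n ih =>
      intro j k
      have e : q ^ j * (commOp q r ^ (n + 1)) (1 : A) * r ^ k =
          q ^ (j + 1) * (commOp q r ^ n) (1 : A) * r ^ k -
            q ^ j * (commOp q r ^ n) (1 : A) * r ^ (k + 1) := by
        rw [commOp_pow_succ_apply, pow_succ q, pow_succ' r]
        noncomm_ring
      rw [e]
      calc _ ≤ _ := norm_sub_le _ _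
        _ ≤ _ := add_le_add (ih (j + 1) k) (ih j (k + 1))
        _ = _ := by ring
  refine IsBigO.of_bound (M * N) (Eventually.of_forall fun n => ?_)
  have := key n 0 0
  simp only [pow_zero, one_mul, mul_one, add_zero] at this
  rw [Real.norm_of_nonneg (by positivity)]
  refine this.trans_eq ?_
  rw [mul_assoc, ← mul_pow]
  congr 2
  ring

/-- Every iterate commutes with `s`, so the extra terms `s * x` and `x * s` cancel. -/
theorem commOp_sub_pow_one {a b s : A} (ha : Commute s a) (hb : Commute s b) (n : ℕ) :
    (commOp (a - s) (b - s) ^ n) (1 : A) = (commOp a b ^ n) (1 : A) := by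
  suffices H : (commOp (a - s) (b - s) ^ n) (1 : A) = (commOp a b ^ n) (1 : A) ∧
      Commute s ((commOp a b ^ n) (1 : A)) from H.1
  induction n with
  | zero => simp
  | succ n ih =>
    simp only [commOp_pow_succ_apply]
    refine ⟨?_, (ha.mul_right ih.2).sub_right (ih.2.mul_right hb)⟩
    rw [ih.1, sub_mul, mul_sub, ih.2.eq]
    abel

/-! ### Riesz projections -/

theorem IsIsolatingRadius.mem_resolventSet {a : A} {z w : ℂ} {r : ℝ}
    (hr : IsIsolatingRadius a z r) (hw : w ∈ sphere z r) : w ∈ resolventSet ℂ a := by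
  by_contra hc
  have : w = z := hr.2 ⟨sphere_subset_closedBall hw, hc⟩
  rw [this, mem_sphere, dist_self] at hw
  exact hr.1.ne hw

theorem continuousOn_resolvent [CompleteSpace A] (a : A) :
    ContinuousOn (resolvent a) (resolventSet ℂ a) := fun _ hw =>
  (spectrum.hasDerivAt_resolvent_const_left hw).continuousAt.continuousWithinAt

theorem exists_isIsolatingRadius {a : A} (ha : (spectrum ℂ a).Finite) (z : ℂ) :
    ∃ r, IsIsolatingRadius a z r := by
  have hmem : (spectrum ℂ a \ {z})ᶜ ∈ 𝓝 z :=
    (ha.subset Set.sdiff_subset).isClosed.isOpen_compl.mem_nhds (by simp)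
  obtain ⟨r, hr, h⟩ := nhds_basis_closedBall.mem_iff.1 hmem
  refine ⟨r, hr, fun w hw => ?_⟩
  by_contra hne
  exact h hw.1 ⟨hw.2, hne⟩

theorem map_resolvent {B : Type*} [NormedRing B] [NormedAlgebra ℂ B] (φ : B →ₐ[ℂ] A) {x : B}
    {w : ℂ} (hw : w ∈ resolventSet ℂ x) : φ (resolvent x w) = resolvent (φ x) w := by
  obtain ⟨u, hu⟩ := spectrum.mem_resolventSet_iff.1 hw
  have h : algebraMap ℂ A w - φ x = (Units.map (φ : B →* A) u : Aˣ) := by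
    simp [hu]
  rw [resolvent, resolvent, ← hu, h, Ring.inverse_unit, Ring.inverse_unit]
  simp [← map_inv]

/-- Used for characters and for the inclusion of a bicommutant. -/
theorem map_rieszProjection [CompleteSpace A] {B : Type*} [NormedRing B] [NormedAlgebra ℂ B]
    [CompleteSpace B] (φ : B →ₐ[ℂ] A) (hφ : Continuous φ) {x : B} {z : ℂ}
    (h : ∃ r, IsIsolatingRadius x z r) : φ (rieszProjection z x) = rieszProjection z (φ x) := by
  obtain ⟨r, hr⟩ := h
  have hr' : IsIsolatingRadius (φ x) z r :=
    ⟨hr.1, fun w hw => hr.2 ⟨hw.1, AlgHom.spectrum_apply_subset φ x hw.2⟩⟩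
  let L : B →L[ℂ] A := ⟨φ.toLinearMap, hφ⟩
  have hL : ∀ y, φ y = L y := fun _ => rfl
  have hint : CircleIntegrable (resolvent x) z r :=
    ((continuousOn_resolvent x).mono fun w hw => hr.mem_resolventSet hw).circleIntegrable hr.1.le
  rw [rieszProjection_eq hr, rieszProjection_eq hr', map_smul]
  congr 1
  have : L (∮ w in C(z, r), resolvent x w) = ∮ w in C(z, r), L (resolvent x w) := by
    simp only [circleIntegral]
    rw [← L.intervalIntegral_comp_comm hint.out]
    simp
  rw [hL, this]
  exact circleIntegral.integral_congr hr.1.le fun w hw => map_resolvent φ (hr.mem_resolventSet hw)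

theorem rieszProjection_complex (z μ : ℂ) :
    rieszProjection z μ = if μ = z then 1 else 0 := by
  have hσ : spectrum ℂ μ = {μ} := spectrum.scalar_eq μ
  obtain ⟨r, hr⟩ := exists_isIsolatingRadius (a := μ) (by simp [hσ]) z
  have hres : resolvent μ = fun w => (w - μ)⁻¹ := by
    ext w
    simp [resolvent]
  rw [rieszProjection_eq hr, hres]
  split_ifs with h
  · subst h
    rw [circleIntegral.integral_sub_center_inv _ hr.1.ne', smul_eq_mul,
      inv_mul_cancel₀ (by simp [Real.pi_ne_zero])]
  · have hμ : ∀ w ∈ closedBall z r, w - μ ≠ 0 := by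
      intro w hw h0
      rw [sub_eq_zero] at h0
      subst h0
      exact h (hr.2 ⟨hw, by simp [hσ]⟩)
    rw [Complex.circleIntegral_eq_zero_of_differentiable_on_off_countable hr.1.le
      Set.countable_empty, smul_zero]
    · exact fun w hw => ((continuousAt_id.sub continuousAt_const).inv₀
        (hμ w hw)).continuousWithinAt
    · exact fun w hw => (differentiableAt_id.sub_const μ).inv (hμ w (ball_subset_closedBall hw.1))

/-! ### The common spectral part, and sufficiency of (i) and (ii). -/

/-- The element `∑ z, z • p(z,a)` for `z` in a finite set of complex numbers. -/
def spectralSum (s : Finset ℂ) (a : A) : A :=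
  ∑ z ∈ s, z • rieszProjection z a

theorem map_spectralSum [CompleteSpace A] {B : Type*} [NormedRing B] [NormedAlgebra ℂ B]
    [CompleteSpace B] (φ : B →ₐ[ℂ] A) (hφ : Continuous φ) {x : B} (hx : (spectrum ℂ x).Finite)
    (s : Finset ℂ) : φ (spectralSum s x) = spectralSum s (φ x) := by
  simp [spectralSum, map_rieszProjection φ hφ (exists_isIsolatingRadius hx _)]

/-- A character `φ` sends the projection at `z` to `1` if `φ x = z` and to `0` otherwise, so it
sends the spectral sum to `φ x` and kills the difference. -/
theorem spectrum_sub_spectralSum_of_comm {B : Type*} [NormedCommRing B] [NormedAlgebra ℂ B]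
    [CompleteSpace B] {x : B} (hx : (spectrum ℂ x).Finite) :
    spectrum ℂ (x - spectralSum hx.toFinset x) ⊆ {0} := by
  intro w hw
  obtain ⟨φ, rfl⟩ := WeakDual.CharacterSpace.mem_spectrum_iff_exists.1 hw
  have hφ : φ x ∈ spectrum ℂ x := WeakDual.CharacterSpace.mem_spectrum_iff_exists.2 ⟨φ, rfl⟩
  have : φ (spectralSum hx.toFinset x) = spectralSum hx.toFinset (φ x) :=
    map_spectralSum (WeakDual.CharacterSpace.toAlgHom φ) (map_continuous φ) hx hx.toFinset
  rw [Set.mem_singleton_iff, map_sub, this, sub_eq_zero]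
  simp [spectralSum, rieszProjection_complex, hφ]

theorem commute_spectralSum_and_spectrum_subset [CompleteSpace A] {a : A}
    (ha : (spectrum ℂ a).Finite) :
    Commute (spectralSum ha.toFinset a) a ∧
      spectrum ℂ (a - spectralSum ha.toFinset a) ⊆ {0} := by
  -- The bicommutant of `a` is closed, commutative and closed under inverses, so `a` has the same
  -- spectrum in it as in `A` and the commutative case applies.
  let B : Subalgebra ℂ A := Subalgebra.centralizer ℂ (Set.centralizer {a})
  have hB : ∀ x, x ∈ B ↔ ∀ y, a * y = y * a → y * x = x * y := by
    intro x
    simp [B, Subalgebra.mem_centralizer_iff, Set.mem_centralizer_iff]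
  have haB : a ∈ B := (hB a).2 fun y hy => hy.symm
  have hcomm : ∀ x y : B, x * y = y * x := fun x y =>
    Subtype.ext ((hB y).1 y.2 x ((hB x).1 x.2 a rfl))
  have hclosed : IsClosed (B : Set A) := Set.isClosed_centralizer _
  have : CompleteSpace B := hclosed.completeSpace_coe
  let _ : NormedCommRing B := { (inferInstance : NormedRing B) with mul_comm := hcomm }
  have hunit : ∀ x : B, IsUnit (x : A) → IsUnit x := by
    rintro x ⟨u, hu⟩
    have hinv : (↑u⁻¹ : A) ∈ B := (hB _).2 fun y hy => by
      have h : Commute y (u : A) := by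
        rw [hu]
        exact (hB _).1 x.2 y hy
      exact h.units_inv_right
    refine IsUnit.of_mul_eq_one (⟨_, hinv⟩ : B) (Subtype.ext ?_)
    change (x : A) * (↑u⁻¹ : A) = 1
    rw [← hu, Units.mul_inv]
  let x : B := ⟨a, haB⟩
  have hσ : spectrum ℂ x ⊆ spectrum ℂ a := fun w hw h => hw (hunit _ h)
  have hx : (spectrum ℂ x).Finite := ha.subset hσ
  have hσ' : spectrum ℂ x = spectrum ℂ a :=
    hσ.antisymm (AlgHom.spectrum_apply_subset B.val x)
  have hfin : hx.toFinset = ha.toFinset := by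
    ext w
    simp [hσ']
  have hs : B.val (spectralSum ha.toFinset x) = spectralSum ha.toFinset a :=
    map_spectralSum B.val continuous_subtype_val hx _
  refine ⟨?_, ?_⟩
  · rw [← hs]
    exact congrArg B.val (hcomm (spectralSum ha.toFinset x) x)
  · have h := AlgHom.spectrum_apply_subset B.val (x - spectralSum ha.toFinset x)
    rw [map_sub, hs] at h
    refine h.trans ?_
    rw [← hfin]
    exact spectrum_sub_spectralSum_of_comm hx

theorem spectralSemidist_eq_zero_of_rieszProjection_eq [CompleteSpace A] {a b : A}
    (ha : (spectrum ℂ a).Finite) (hσ : spectrum ℂ a = spectrum ℂ b)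
    (hp : ∀ z ∈ spectrum ℂ a, rieszProjection z a = rieszProjection z b) :
    spectralSemidist a b = 0 := by
  have hb : (spectrum ℂ b).Finite := hσ ▸ ha
  have hs : spectralSum hb.toFinset b = spectralSum ha.toFinset a := by
    have : hb.toFinset = ha.toFinset := by
      ext w
      simp [hσ]
    rw [this]
    exact Finset.sum_congr rfl fun z hz => by rw [hp z (by simpa using hz)]
  obtain ⟨hca, hqa⟩ := commute_spectralSum_and_spectrum_subset ha
  obtain ⟨hcb, hqb⟩ := commute_spectralSum_and_spectrum_subset hb
  rw [hs] at hcb hqb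
  have hqa' := isSubgeometric_pow_of_spectrum_subset hqa
  have hqb' := isSubgeometric_pow_of_spectrum_subset hqb
  rw [spectralSemidist_eq_zero_iff, rho_eq_zero_iff, rho_eq_zero_iff]
  simp only [← commOp_sub_pow_one hca hcb, ← commOp_sub_pow_one hcb hca]
  exact ⟨isSubgeometric_commOp_pow_one hqa' hqb', isSubgeometric_commOp_pow_one hqb' hqa'⟩

end

/-! ### Expansion of the resolvent -/

variable {A : Type*} [NormedRing A]

/-- The rate `1 / (2 * K)` beats the growth `K ^ n` of the powers and leaves the ratio `1 / 2`. -/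
theorem norm_mul_pow_le_geometric {u : ℕ → A} {M K : ℝ} (hK : 0 < K)
    (hu : ∀ n, ‖u n‖ ≤ M * (1 / (2 * K)) ^ n) {x : A} (hx : ‖x‖ ≤ K) (n : ℕ) :
    ‖x ^ (n + 1)‖ * ‖u n‖ ≤ K * M * (1 / 2) ^ n := by
  calc ‖x ^ (n + 1)‖ * ‖u n‖ ≤ K ^ (n + 1) * (M * (1 / (2 * K)) ^ n) := by
        gcongr
        · exact (norm_pow_le' x n.succ_pos).trans (by gcongr)
        · exact hu n
    _ = K * M * (K * (1 / (2 * K))) ^ n := by rw [mul_pow]; ring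
    _ = _ := by congr 2; field_simp

theorem hasSum_sub_succ {g : ℕ → A} (hg : Summable g) :
    HasSum (fun n => g n - g (n + 1)) (g 0) := by
  have h := (hasSum_nat_add_iff' 1).2 hg.hasSum
  simpa using hg.hasSum.sub h

variable [NormedAlgebra ℂ A]

/-- The terms `(-1)^n (w - a)^{-(n+1)} C_{a,b}^n 1` of the expansion of `(w - b)⁻¹`. -/
def resolventTerm (a b : A) (n : ℕ) (w : ℂ) : A :=
  (-1 : ℂ) ^ n • (resolvent a w ^ (n + 1) * (commOp a b ^ n) (1 : A))

theorem norm_resolventTerm_le {a b : A} {M K : ℝ} (hK : 0 < K)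
    (hu : ∀ n, ‖(commOp a b ^ n) (1 : A)‖ ≤ M * (1 / (2 * K)) ^ n) {w : ℂ}
    (hw : ‖resolvent a w‖ ≤ K) (n : ℕ) :
    ‖resolventTerm a b n w‖ ≤ K * M * (1 / 2) ^ n := by
  rw [resolventTerm, norm_smul, norm_pow, norm_neg, norm_one, one_pow, one_mul]
  exact (norm_mul_le _ _).trans (norm_mul_pow_le_geometric hK hu hw n)

theorem resolvent_mul_sub {a : A} {w : ℂ} (hw : w ∈ resolventSet ℂ a) :
    resolvent a w * (algebraMap ℂ A w - a) = 1 := Ring.inverse_mul_cancel _ hw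

theorem sub_mul_resolvent {a : A} {w : ℂ} (hw : w ∈ resolventSet ℂ a) :
    (algebraMap ℂ A w - a) * resolvent a w = 1 := Ring.mul_inverse_cancel _ hw

theorem summable_resolventTerm [CompleteSpace A] {a b : A}
    (h : IsSubgeometric fun n => (commOp a b ^ n) (1 : A)) (w : ℂ) :
    Summable fun n => resolventTerm a b n w := by
  -- The `+ 1` keeps the bound positive even where `resolvent a w` is zero, its default value on the
  -- spectrum.
  have hK : 0 < ‖resolvent a w‖ + 1 := by positivity
  obtain ⟨M, -, hM⟩ := h.exists_bound (ε := 1 / (2 * (‖resolvent a w‖ + 1))) (by positivity)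
  exact Summable.of_norm_bounded (summable_geometric_two.mul_left _)
    (norm_resolventTerm_le hK hM (by linarith))

theorem tsum_resolventTerm_mul_sub [CompleteSpace A] {a b : A}
    (h : IsSubgeometric fun n => (commOp a b ^ n) (1 : A)) {w : ℂ} (hw : w ∈ resolventSet ℂ a) :
    (∑' n, resolventTerm a b n w) * (algebraMap ℂ A w - b) = 1 := by
  have hs := summable_resolventTerm h w
  have hg : ∀ n, (algebraMap ℂ A w - a) * resolventTerm a b n w =
      (-1 : ℂ) ^ n • (resolvent a w ^ n * (commOp a b ^ n) (1 : A)) := fun n => by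
    rw [resolventTerm, mul_smul_comm, pow_succ', ← mul_assoc, ← mul_assoc, sub_mul_resolvent hw,
      one_mul]
  have ht := hasSum_sub_succ ((hs.mul_left (algebraMap ℂ A w - a)).congr fun n => (hg n))
  -- With `d_n = C_{a,b}^n 1`, the relation `d_n (w - b) = (w - a) d_n + d_{n+1}` makes the series
  -- telescope.
  have hterm : ∀ n, (-1 : ℂ) ^ n • (resolvent a w ^ n * (commOp a b ^ n) (1 : A)) -
      (-1 : ℂ) ^ (n + 1) • (resolvent a w ^ (n + 1) * (commOp a b ^ (n + 1)) (1 : A)) =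
        resolventTerm a b n w * (algebraMap ℂ A w - b) := fun n => by
    have h1 : (commOp a b ^ n) (1 : A) * (algebraMap ℂ A w - b) =
        (algebraMap ℂ A w - a) * (commOp a b ^ n) (1 : A) + (commOp a b ^ (n + 1)) (1 : A) := by
      simp only [commOp_pow_succ_apply, sub_mul, mul_sub, Algebra.commutes]
      abel
    rw [resolventTerm, smul_mul_assoc, mul_assoc, h1, mul_add, ← mul_assoc,
      pow_succ (resolvent a w), mul_assoc (_ ^ n) _ (_ - _), resolvent_mul_sub hw, mul_one,
      pow_succ (-1 : ℂ), mul_neg_one, neg_smul, sub_neg_eq_add, smul_add]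
  have h0 : (-1 : ℂ) ^ 0 • (resolvent a w ^ 0 * (commOp a b ^ 0) (1 : A)) = 1 := by simp
  simp only [hterm] at ht
  rw [h0] at ht
  exact (hs.hasSum.mul_right _).unique ht

/-- The mirrored series `∑ (C_{b,a}^n 1) (w - a)^{-(n+1)}`, without signs, provides the inverse on
the other side; this is where `ρ(b,a) = 0` enters. -/
theorem exists_sub_mul_eq_one [CompleteSpace A] {a b : A}
    (h : IsSubgeometric fun n => (commOp b a ^ n) (1 : A)) {w : ℂ} (hw : w ∈ resolventSet ℂ a) :
    ∃ y, (algebraMap ℂ A w - b) * y = 1 := by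
  set R := resolvent a w
  set d : ℕ → A := fun n => (commOp b a ^ n) (1 : A)
  have hK : 0 < ‖R‖ + 1 := by positivity
  obtain ⟨M, -, hM⟩ := h.exists_bound (ε := 1 / (2 * (‖R‖ + 1))) (by positivity)
  have hs : Summable fun n => d n * R ^ (n + 1) :=
    Summable.of_norm_bounded (summable_geometric_two.mul_left ((‖R‖ + 1) * M)) fun n =>
      (norm_mul_le _ _).trans ((mul_comm _ _).trans_le
        (norm_mul_pow_le_geometric hK hM (by linarith) n))
  have hg : ∀ n, d n * R ^ (n + 1) * (algebraMap ℂ A w - a) = d n * R ^ n := fun n => by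
    rw [pow_succ, mul_assoc, mul_assoc, resolvent_mul_sub hw, mul_one]
  have ht := hasSum_sub_succ ((hs.mul_right (algebraMap ℂ A w - a)).congr fun n => (hg n))
  have hterm : ∀ n, d n * R ^ n - d (n + 1) * R ^ (n + 1) =
      (algebraMap ℂ A w - b) * (d n * R ^ (n + 1)) := fun n => by
    have h1 : (algebraMap ℂ A w - b) * d n = d n * (algebraMap ℂ A w - a) - d (n + 1) := by
      simp only [d, commOp_pow_succ_apply, sub_mul, mul_sub, Algebra.commutes]
      abel
    rw [← mul_assoc, h1, sub_mul, mul_assoc (d n), pow_succ' R,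
      ← mul_assoc (algebraMap ℂ A w - a), sub_mul_resolvent hw, one_mul]
  have h0 : d 0 * R ^ 0 = 1 := by simp [d]
  simp only [hterm] at ht
  rw [h0] at ht
  exact ⟨_, (hs.hasSum.mul_left _).unique ht⟩

theorem resolventSet_subset [CompleteSpace A] {a b : A}
    (hab : IsSubgeometric fun n => (commOp a b ^ n) (1 : A))
    (hba : IsSubgeometric fun n => (commOp b a ^ n) (1 : A)) :
    resolventSet ℂ a ⊆ resolventSet ℂ b := fun w hw => by
  obtain ⟨y, hy⟩ := exists_sub_mul_eq_one hba hw
  exact isUnit_iff_exists_and_exists.2 ⟨⟨y, hy⟩, _, tsum_resolventTerm_mul_sub hab hw⟩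

theorem spectrum_eq_of_isSubgeometric [CompleteSpace A] {a b : A}
    (hab : IsSubgeometric fun n => (commOp a b ^ n) (1 : A))
    (hba : IsSubgeometric fun n => (commOp b a ^ n) (1 : A)) :
    spectrum ℂ a = spectrum ℂ b :=
  (Set.compl_subset_compl.2 (resolventSet_subset hba hab)).antisymm
    (Set.compl_subset_compl.2 (resolventSet_subset hab hba))

/-! ### Termwise integration and equality of the projections. -/

theorem hasDerivAt_resolvent_pow [CompleteSpace A] {a : A} {w : ℂ} (hw : w ∈ resolventSet ℂ a)
    (n : ℕ) :
    HasDerivAt (fun w => resolvent a w ^ n) (-(n : ℂ) • resolvent a w ^ (n + 1)) w := by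
  convert (spectrum.hasDerivAt_resolvent_const_left hw).fun_pow' n using 1
  have : ∀ i ∈ Finset.range n, resolvent a w ^ (n.pred - i) * -resolvent a w ^ 2 *
      resolvent a w ^ i = -resolvent a w ^ (n + 1) := fun i hi => by
    have hi' := Finset.mem_range.1 hi
    rw [mul_neg, neg_mul, ← pow_add, ← pow_add]
    congr 2
    have := Nat.pred_eq_sub_one (n := n)
    omega
  rw [Finset.sum_congr rfl this, Finset.sum_const, Finset.card_range, smul_neg, neg_smul,
    Nat.cast_smul_eq_nsmul]

/-- Powers of the resolvent of order at least two have single-valued primitives, so their integrals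
over a closed circle vanish. -/
theorem circleIntegral_resolventTerm_succ [CompleteSpace A] {a b : A} {z : ℂ} {r : ℝ}
    (hr : IsIsolatingRadius a z r) (n : ℕ) :
    (∮ w in C(z, r), resolventTerm a b (n + 1) w) = 0 := by
  refine circleIntegral.integral_eq_zero_of_hasDerivWithinAt
    (f := fun w => ((-1 : ℂ) ^ (n + 1) * -((n + 1 : ℕ) : ℂ)⁻¹) •
      (resolvent a w ^ (n + 1) * (commOp a b ^ (n + 1)) (1 : A))) hr.1.le fun w hw => ?_
  have h := ((hasDerivAt_resolvent_pow (hr.mem_resolventSet hw) (n + 1)).mul_const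
    ((commOp a b ^ (n + 1)) (1 : A))).const_smul ((-1 : ℂ) ^ (n + 1) * -((n + 1 : ℕ) : ℂ)⁻¹)
  have hn : ((n + 1 : ℕ) : ℂ) ≠ 0 := Nat.cast_ne_zero.2 n.succ_ne_zero
  refine h.hasDerivWithinAt.congr_deriv ?_
  rw [resolventTerm, smul_mul_assoc, smul_smul]
  congr 1
  field_simp

theorem rieszProjection_eq_of_isSubgeometric [CompleteSpace A] {a b : A}
    (hab : IsSubgeometric fun n => (commOp a b ^ n) (1 : A))
    (hba : IsSubgeometric fun n => (commOp b a ^ n) (1 : A)) {z : ℂ} {r : ℝ}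
    (hr : IsIsolatingRadius a z r) : rieszProjection z a = rieszProjection z b := by
  have hrb : IsIsolatingRadius b z r :=
    ⟨hr.1, (spectrum_eq_of_isSubgeometric hab hba) ▸ hr.2⟩
  rw [rieszProjection_eq hr, rieszProjection_eq hrb]
  congr 1
  have hcont : ContinuousOn (resolvent a) (sphere z r) :=
    (continuousOn_resolvent a).mono fun w hw => hr.mem_resolventSet hw
  have hterm : ∀ n, ContinuousOn (resolventTerm a b n) (sphere z r) := fun n =>
    ((hcont.pow (n + 1)).mul continuousOn_const).const_smul _
  obtain ⟨K, hK⟩ := (isCompact_sphere z r).exists_bound_of_continuousOn hcont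
  have hK1 : 0 < max K 1 := by positivity
  obtain ⟨M, -, hM⟩ := hab.exists_bound (ε := 1 / (2 * max K 1)) (by positivity)
  -- The resolvent of `a` is bounded on the circle, so the expansion converges uniformly there and
  -- may be integrated termwise.
  have hunif := tendstoUniformlyOn_tsum_nat (f := resolventTerm a b)
    (summable_geometric_two.mul_left (max K 1 * M)) (s := sphere z r) fun n w hw =>
      norm_resolventTerm_le hK1 hM ((hK w hw).trans (le_max_left _ _)) n
  have hlim := hunif.tendsto_circleIntegral_of_continuousOn hr.1.le
    (Eventually.of_forall fun N => continuousOn_finsetSum _ fun n _ => hterm n)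
  -- The range `N + 1` ensures that the term `n = 0`, the only one with a possibly nonzero integral,
  -- is present.
  have hpart : ∀ N, (∮ w in C(z, r), ∑ n ∈ Finset.range (N + 1), resolventTerm a b n w) =
      ∮ w in C(z, r), resolvent a w := fun N => by
    rw [circleIntegral.integral_fun_sum fun n _ => (hterm n).circleIntegrable hr.1.le,
      Finset.sum_range_succ']
    simp [circleIntegral_resolventTerm_succ hr]
    simp [resolventTerm]
  have hsum : (∮ w in C(z, r), ∑' n, resolventTerm a b n w) = ∮ w in C(z, r), resolvent b w := by
    refine circleIntegral.integral_congr hr.1.le fun w hw => ?_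
    exact left_inv_eq_right_inv
      (tsum_resolventTerm_mul_sub hab (hr.mem_resolventSet hw))
      (sub_mul_resolvent (hrb.mem_resolventSet hw))
  rw [← hsum]
  refine tendsto_nhds_unique ?_ (hlim.comp (tendsto_add_atTop_nat 1))
  simp only [Function.comp_def, hpart]
  exact tendsto_const_nhds

end

end BanachAlg

theorem mainTheorem1 {A : Type*} [NormedRing A] [NormedAlgebra ℂ A] [CompleteSpace A]
    (a b : A) (ha : (spectrum ℂ a).Finite) :
    BanachAlg.spectralSemidist a b = 0 ↔
      spectrum ℂ a = spectrum ℂ b ∧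
        ∀ z ∈ spectrum ℂ a, BanachAlg.rieszProjection z a = BanachAlg.rieszProjection z b := by
  refine ⟨fun h => ?_, fun h =>
    BanachAlg.spectralSemidist_eq_zero_of_rieszProjection_eq ha h.1 h.2⟩
  obtain ⟨hab, hba⟩ := BanachAlg.spectralSemidist_eq_zero_iff.1 h
  rw [BanachAlg.rho_eq_zero_iff] at hab hba
  refine ⟨BanachAlg.spectrum_eq_of_isSubgeometric hab hba, fun z _ => ?_⟩
  obtain ⟨r, hr⟩ := BanachAlg.exists_isIsolatingRadius ha z
  exact BanachAlg.rieszProjection_eq_of_isSubgeometric hab hba hr
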